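/- Let $U$ be a universe of $m$ IDs. A stream $S=(i_1,d_1),\dots,(i_t,d_t)$ is a finite sequence of updates in $U\times\mathbb Z$; its state vector $\mathbf a\in\mathbb Z^U$ has entries $a_i=\sum_{j:\,i_j=i}d_j$. In the turnstile model all streams are allowed, in the cash register model only those with all $d_j\ge 0$. Two streams $S,S'$ are neighbors if for some IDs $i\neq j$ there are a set $K$ of positions of $S$, all updating $i$, and a set $K'$ of positions of $S'$, all updating $j$, with $\sum_{k\in K}d_k=\sum_{k\in K'}d'_k$, such that for every ID the remaining updates of $S$ and the remaining updates of $S'$ have the same sum. A (randomized) online algorithm for inputs consisting of a stream $S$ followed by a stream $S'$ processes the updates one at a time (each labelled with the stream it belongs to), with fresh coins, in an arbitrary, possibly unbounded, state space; when queried it outputs a real number computed, with fresh coins, from its current internal state. Two inputs are neighbors if one of their two streams is replaced by a neighbor and the other is unchanged. The algorithm is $\varepsilon$-pan-private (against a single intrusion) if for all allowed neighboring inputs $x,x'$ and all measurable sets $I'$ of internal states and $\sigma'$ of outputs, the pair $\mathrm{Alg}(x)$ of internal state and output satisfies $\Pr[\mathrm{Alg}(x)\in I'\times\sigma']\le e^{\varepsilon}\Pr[\mathrm{Alg}(x')\in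 I'\times\sigma']$. Let $\rho^*=\Pr\big[|g|>\sqrt{2\ln 2}\big]\approx 0.239$, where $g$ is a standard Gaussian random variable. **Theorem.** Fix the cash register or the turnstile model. For each $m$ let $\mathcal A_m$ be an online algorithm over a universe of $m$ IDs, let $\alpha(m)=o(\sqrt m)$, and let $\delta$ and $\eta>0$ be constants with $\delta<\dfrac{\rho^*}{2(1+\eta)}$. Suppose that for all sufficiently large $m$ and all allowed streams $S$, $S'$ with state vectors $\mathbf a,\mathbf a'$, the algorithm $\mathcal A_m$ on input $S$ followed by $S'$ outputs a number within $\alpha(m)$ of $\mathbf a\cdot\mathbf a'=\sum_{i\in U}a_ia'_i$ with probability at least $1-\delta$. Then for every constant $\varepsilon$, for all sufficiently large $m$, $\mathcal A_m$ is not $\varepsilon$-pan-private. -/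

import Mathlib

open MeasureTheory ProbabilityTheory Filter Asymptotics

universe u

namespace PanPrivacy

/-- The tail mass `ℙ(|g| > √(2 log 2))` of a standard Gaussian `g`; numerically `0.2390…`.
The threshold `t = √(2 log 2)` is the one at which `𝔼[|g|; |g| > t] = 𝔼|g| / 2`, so this is the
fraction of largest coordinates that carries half of the `ℓ₁` mass of a Gaussian vector: the error
tolerance of linear-programming decoding. -/
noncomputable def rhoStar : ℝ :=
  (gaussianReal 0 1).real {x : ℝ | √(2 * Real.log 2) < |x|}

/-- An update `(i, d)`: the amount `d` is added to the entry of the ID `i`, where the universe of IDs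
has `m` elements. -/
abbrev Update (m : ℕ) : Type := Fin m × ℤ

/-- A finite stream of updates, in order of arrival. -/
abbrev Updates (m : ℕ) : Type := List (Update m)

/-- The state vector of a stream: `a i = ∑_{j : i_j = i} d_j`. -/
def stateVector {m : ℕ} (S : Updates m) (i : Fin m) : ℤ :=
  ((S.filter (fun u => u.1 = i)).map Prod.snd).sum

/-- The dot product of the state vectors of two streams. -/
def dotProd {m : ℕ} (S T : Updates m) : ℤ :=
  ∑ i, stateVector S i * stateVector T i

/-- The two models of streams. -/
inductive StreamModel : Type
  | cashRegister
  | turnstile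

/-- In the cash register model all updates are nonnegative; in the turnstile model all streams are
allowed. -/
def StreamModel.Allows {m : ℕ} : StreamModel → Updates m → Prop
  | .cashRegister, S => ∀ u ∈ S, 0 ≤ u.2
  | .turnstile, _ => True

/-- User-level neighbors: some updates of one ID `i` in `S` (those indexed by `K`) are replaced in
`S'` by updates of one other ID `j` (those indexed by `K'`) with the same total, and the remaining
updates of `S` and `S'` have the same total for every ID. -/
def Neighbors {m : ℕ} (S S' : Updates m) : Prop :=
  ∃ i j : Fin m, i ≠ j ∧
    ∃ (K : Finset (Fin S.length)) (K' : Finset (Fin S'.length)),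
      (∀ k ∈ K, (S.get k).1 = i) ∧ (∀ k ∈ K', (S'.get k).1 = j) ∧
      ∑ k ∈ K, (S.get k).2 = ∑ k ∈ K', (S'.get k).2 ∧
      ∀ l : Fin m,
        ∑ k ∈ Kᶜ with (S.get k).1 = l, (S.get k).2 =
          ∑ k ∈ K'ᶜ with (S'.get k).1 = l, (S'.get k).2

/-- Neighboring inputs, for an input that consists of a stream `S` followed by a stream `T`: one of
the two streams is replaced by a neighbor, the other one is unchanged. -/
def NeighborInputs {m : ℕ} (S T S' T' : Updates m) : Prop :=
  (Neighbors S S' ∧ T = T') ∨ (S = S' ∧ Neighbors T T')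

/-- The label of an update that tells which of the two streams it belongs to. -/
inductive StreamLabel : Type
  | first
  | second

/-- A randomized online algorithm that reads updates of two streams over a universe of `m` IDs.
The state space is arbitrary (no bound on memory). Each update is processed with fresh coins and
changes the internal state; when queried, the algorithm outputs a real number, computed with fresh
coins from the current state. Everything that the algorithm remembers is part of its state. -/
structure OnlineAlgorithm (m : ℕ) where
  State : Type u
  [measurableSpaceState : MeasurableSpace State]
  init : Measure State
  [isProbabilityMeasure_init : IsProbabilityMeasure init]
  step : StreamLabel → Update m → Kernel State State
  [isMarkovKernel_step : ∀ c x, IsMarkovKernel (step c x)]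
  output : Kernel State ℝ
  [isMarkovKernel_output : IsMarkovKernel output]

namespace OnlineAlgorithm

attribute [instance] measurableSpaceState isProbabilityMeasure_init isMarkovKernel_step
  isMarkovKernel_output

variable {m : ℕ} (A : OnlineAlgorithm.{u} m)

/-- The law of the state after processing a list of updates of the stream with label `c`, started
from a state with law `μ`. -/
noncomputable def process (c : StreamLabel) (μ : Measure A.State) (S : Updates m) :
    Measure A.State :=
  S.foldl (fun ν x => ν.bind (A.step c x)) μ

/-- The law of the internal state after the first stream `S` followed by the second stream `T`. -/
noncomputable def stateLaw (S T : Updates m) : Measure A.State :=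
  A.process .second (A.process .first A.init S) T

/-- The joint law of the internal state and the output after the input `S` followed by `T`. -/
noncomputable def law (S T : Updates m) : Measure (A.State × ℝ) :=
  (A.stateLaw S T).compProd A.output

instance isProbabilityMeasure_process (c : StreamLabel) (μ : Measure A.State)
    [hμ : IsProbabilityMeasure μ] (S : Updates m) : IsProbabilityMeasure (A.process c μ S) := by
  induction S generalizing μ with
  | nil => exact hμ
  | cons x S ih => exact ih (μ.bind (A.step c x))

instance isProbabilityMeasure_stateLaw (S T : Updates m) :
    IsProbabilityMeasure (A.stateLaw S T) := by
  unfold stateLaw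
  infer_instance

instance isProbabilityMeasure_law (S T : Updates m) : IsProbabilityMeasure (A.law S T) := by
  unfold law
  infer_instance

/-- On every input of the model, `S` followed by `T`, the output is within `α` of the dot product
of the state vectors of `S` and `T` with probability at least `1 - δ`. -/
def ApproximatesDotProd (M : StreamModel) (α δ : ℝ) : Prop :=
  ∀ S T : Updates m, M.Allows S → M.Allows T →
    1 - δ ≤ (A.law S T).real {p | |p.2 - (dotProd S T : ℝ)| ≤ α}

/-- User-level `ε`-pan-privacy against a single intrusion. -/
def IsPanPrivate (M : StreamModel) (ε : ℝ) : Prop :=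
  ∀ S T S' T' : Updates m, M.Allows S → M.Allows T → M.Allows S' → M.Allows T' →
    NeighborInputs S T S' T' →
      ∀ (I : Set A.State) (Y : Set ℝ), MeasurableSet I → MeasurableSet Y →
        A.law S T (I ×ˢ Y) ≤ ENNReal.ofReal (Real.exp ε) * A.law S' T' (I ×ˢ Y)

end OnlineAlgorithm

end PanPrivacy

namespace PanPrivacy

/-! Let the first stream be a single update `(i, d)` with `d > 2α`, and the second a 0-1 vector `r`.
The dot product is `d` or `0` according to the bit `r i`, so comparing the output with `d / 2`
guesses that bit with error at most `δ < 1/2`. Fix the state `s` between the two streams. The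
expected `±1` guess is a function of `r` with values in `[-1, 1]`, and its correlations with the
coordinates of `r` are degree-one Fourier coefficients. Their squares sum to at most 1 by Bessel
(`sum_sq_correlation_le`): no state can serve many IDs well. If the first stream updates `i`, the
`i`-th correlation has mean at least `1 - 2δ`, hence second moment at least `(1 - 2δ)²`. Privacy
transfers these second moments, up to `exp ε`, to the state law of one fixed ID `i₀`. Summing over
`i ≠ i₀` gives `(m - 1)(1 - 2δ)² ≤ exp ε`, which bounds `m`. -/

/-- The `±1`-valued coordinate characters of the Boolean cube. -/
def sign {m : ℕ} (i : Fin m) (r : Fin m → Bool) : ℝ := if r i then 1 else -1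

theorem sign_mul_self {m : ℕ} (i : Fin m) (r : Fin m → Bool) : sign i r * sign i r = 1 := by
  unfold sign; split_ifs <;> norm_num

theorem sum_sign_mul_sign {m : ℕ} {i j : Fin m} (hij : i ≠ j) :
    ∑ r : Fin m → Bool, sign i r * sign j r = 0 := by
  -- Flipping the bit `i` negates the character of `i` and preserves that of `j`, so the terms
  -- cancel in pairs.
  refine Finset.sum_involution (fun r _ => Function.update r i (!r i)) ?_ ?_ ?_ ?_
  · intro r _
    simp only [sign, Function.update_self, Function.update_of_ne hij.symm]
    cases r i <;> cases r j <;> simp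
  · intro r _ _ h
    have := congrFun h i
    simp at this
  · simp
  · simp

/-- Bessel's inequality for the coordinate characters of the Boolean cube. -/
theorem sum_sq_correlation_le {m : ℕ} (f : (Fin m → Bool) → ℝ) (hf : ∀ r, f r ^ 2 ≤ 1) :
    ∑ i, ((∑ r, sign i r * f r) / 2 ^ m) ^ 2 ≤ 1 := by
  set a : Fin m → ℝ := fun i => (∑ r, sign i r * f r) / 2 ^ m with ha
  have hN : (0 : ℝ) < 2 ^ m := by positivity
  have ha' : ∀ i, ∑ r, sign i r * f r = 2 ^ m * a i := fun i => by
    rw [ha]; field_simp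
  have hcard : ∑ _r : Fin m → Bool, (1 : ℝ) = 2 ^ m := by simp
  have hfh : ∑ r, f r * ∑ i, a i * sign i r = 2 ^ m * ∑ i, a i ^ 2 := by
    simp_rw [Finset.mul_sum]
    rw [Finset.sum_comm]
    refine Finset.sum_congr rfl fun i _ => ?_
    have : ∀ r, f r * (a i * sign i r) = a i * (sign i r * f r) := fun r => by ring
    simp_rw [this, ← Finset.mul_sum, ha']
    ring
  have hhh : ∑ r, (∑ i, a i * sign i r) ^ 2 = 2 ^ m * ∑ i, a i ^ 2 := by
    simp_rw [sq, Finset.sum_mul_sum]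
    rw [Finset.sum_comm, Finset.mul_sum]
    refine Finset.sum_congr rfl fun i _ => ?_
    rw [Finset.sum_comm]
    have : ∀ j r, a i * sign i r * (a j * sign j r) = a i * a j * (sign i r * sign j r) :=
      fun j r => by ring
    simp_rw [this, ← Finset.mul_sum]
    rw [Finset.sum_eq_single i]
    · simp_rw [sign_mul_self, hcard]; ring
    · intro j _ hj
      rw [sum_sign_mul_sign hj.symm, mul_zero]
    · simp
  have hff : ∑ r, f r ^ 2 ≤ 2 ^ m := hcard ▸ Finset.sum_le_sum fun r _ => hf r
  -- The squared distance from `f` to its projection on the span of the characters is nonnegative.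
  have h0 : 0 ≤ ∑ r, (f r - ∑ i, a i * sign i r) ^ 2 := Finset.sum_nonneg fun r _ => sq_nonneg _
  have hexp : ∑ r, (f r - ∑ i, a i * sign i r) ^ 2 =
      ∑ r, f r ^ 2 - 2 * ∑ r, f r * ∑ i, a i * sign i r + ∑ r, (∑ i, a i * sign i r) ^ 2 := by
    rw [Finset.mul_sum, ← Finset.sum_sub_distrib, ← Finset.sum_add_distrib]
    exact Finset.sum_congr rfl fun r _ => by ring
  rw [hexp, hfh, hhh] at h0
  have : 2 ^ m * ∑ i, a i ^ 2 ≤ 2 ^ m * 1 := by linarith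
  exact le_of_mul_le_mul_left this hN

/-! ### Test streams and their state vectors -/

theorem stateVector_eq_sum {m : ℕ} (S : Updates m) (i : Fin m) :
    stateVector S i = (S.map fun u => if u.1 = i then u.2 else 0).sum := by
  unfold stateVector
  induction S with
  | nil => simp
  | cons u S ih => by_cases h : u.1 = i <;> simp [h, ih]

/-- The stream that consists of one update for each ID and has the state vector `w`. -/
def streamOf {m : ℕ} (w : Fin m → ℤ) : Updates m := List.ofFn fun k => (k, w k)

theorem stateVector_streamOf {m : ℕ} (w : Fin m → ℤ) : stateVector (streamOf w) = w := by
  ext i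
  simp [stateVector_eq_sum, streamOf, List.map_ofFn, List.sum_ofFn]

theorem dotProd_singleton_streamOf {m : ℕ} (i : Fin m) (d : ℤ) (w : Fin m → ℤ) :
    dotProd [(i, d)] (streamOf w) = d * w i := by
  simp_rw [dotProd, stateVector_streamOf]
  simp [stateVector_eq_sum]

theorem allows_singleton {m : ℕ} (M : StreamModel) (i : Fin m) {d : ℤ} (hd : 0 ≤ d) :
    M.Allows [(i, d)] := by
  cases M <;> simp [StreamModel.Allows, hd]

theorem allows_streamOf {m : ℕ} (M : StreamModel) {w : Fin m → ℤ} (hw : ∀ i, 0 ≤ w i) :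
    M.Allows (streamOf w) := by
  cases M
  · intro u hu
    obtain ⟨k, rfl⟩ := (List.mem_ofFn' _ _).1 hu
    exact hw k
  · trivial

theorem allows_nil {m : ℕ} (M : StreamModel) : M.Allows ([] : Updates m) := by
  cases M <;> simp [StreamModel.Allows]

theorem neighbors_singleton {m : ℕ} {i j : Fin m} (hij : i ≠ j) (d : ℤ) :
    Neighbors [(i, d)] [(j, d)] := by
  refine ⟨i, j, hij, Finset.univ, Finset.univ, ?_, ?_, ?_, fun l => ?_⟩
  · simp
  · simp
  · simp
  · simp only [Finset.compl_univ, Finset.filter_empty, Finset.sum_empty]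

theorem rhoStar_le_one : rhoStar ≤ 1 := measureReal_le_one

/-! ### The state between the two streams -/

namespace OnlineAlgorithm

variable {m : ℕ} (A : OnlineAlgorithm.{u} m)

/-- The output law of the algorithm as a function of the state before the second stream. -/
noncomputable def answer : Updates m → Kernel A.State ℝ
  | [] => A.output
  | x :: T => (answer T).comp (A.step .second x)

instance isMarkovKernel_answer (T : Updates m) : IsMarkovKernel (A.answer T) := by
  induction T with
  | nil => exact A.isMarkovKernel_output
  | cons x T ih => unfold answer; infer_instance

theorem bind_output_process (μ : Measure A.State) (T : Updates m) :
    (A.process .second μ T).bind A.output = μ.bind (A.answer T) := by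
  induction T generalizing μ with
  | nil => rfl
  | cons x T ih =>
    change (A.process .second (μ.bind (A.step .second x)) T).bind A.output = _
    rw [ih, answer, Measure.comp_assoc]

/-- The law of the internal state after the first stream. -/
noncomputable def firstLaw (S : Updates m) : Measure A.State := A.process .first A.init S

instance isProbabilityMeasure_firstLaw (S : Updates m) : IsProbabilityMeasure (A.firstLaw S) := by
  unfold firstLaw; infer_instance

theorem law_real_snd (S T : Updates m) {Y : Set ℝ} (hY : MeasurableSet Y) :
    (A.law S T).real {p | p.2 ∈ Y} = ∫ s, (A.answer T s).real Y ∂A.firstLaw S := by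
  have h : A.law S T {p | p.2 ∈ Y} = ((A.firstLaw S).bind (A.answer T)) Y := by
    rw [firstLaw, ← bind_output_process, ← Measure.snd_compProd, Measure.snd_apply hY]
    rfl
  rw [measureReal_def, h, Measure.bind_apply hY (Kernel.aemeasurable _)]
  simp_rw [measureReal_def]
  rw [integral_toReal (Kernel.measurable_coe _ hY).aemeasurable (ae_of_all _ fun s => measure_lt_top _ _)]

variable {A}

/-- With an empty second stream and no restriction on the output, pan-privacy speaks of the
intermediate state alone. -/
theorem IsPanPrivate.firstLaw_le {M : StreamModel} {ε : ℝ} (h : A.IsPanPrivate M ε)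
    {S S' : Updates m} (hS : M.Allows S) (hS' : M.Allows S') (hn : Neighbors S S') :
    A.firstLaw S ≤ ENNReal.ofReal (Real.exp ε) • A.firstLaw S' := by
  have hlaw : ∀ (R : Updates m) (I : Set A.State), MeasurableSet I →
      A.law R [] (I ×ˢ Set.univ) = A.firstLaw R I := fun R I hI => by
    rw [law, Measure.compProd_apply_prod hI .univ]
    simp [firstLaw, stateLaw, process]
  refine Measure.le_iff.2 fun I hI => ?_
  have := h S [] S' [] hS (allows_nil M) hS' (allows_nil M) (.inl ⟨hn, rfl⟩) I Set.univ hI .univ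
  rwa [hlaw _ _ hI, hlaw _ _ hI] at this

/-! ### Advantage in guessing the queried bits -/

variable (A)

/-- The `0`-`1` state vector as integers. -/
def bits (r : Fin m → Bool) (i : Fin m) : ℤ := if r i then 1 else 0

/-- The advantage over random guessing, from a given state, of `answer > t` as a prediction of
whether the ID `i` belongs to the set that is queried by a random `0`-`1` stream. -/
noncomputable def advantage (t : ℝ) (i : Fin m) (s : A.State) : ℝ :=
  (∑ r, sign i r * (2 * (A.answer (streamOf (bits r)) s).real (Set.Ioi t) - 1)) / 2 ^ m

theorem measurable_answer_real (T : Updates m) (t : ℝ) :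
    Measurable fun s => (A.answer T s).real (Set.Ioi t) :=
  (Kernel.measurable_coe _ measurableSet_Ioi).ennreal_toReal

theorem measurable_advantage (t : ℝ) (i : Fin m) : Measurable (A.advantage t i) := by
  refine Measurable.div_const (Finset.measurable_fun_sum _ fun r _ => ?_) _
  exact (((A.measurable_answer_real _ t).const_mul 2).sub_const 1).const_mul _

theorem sum_sq_advantage_le (t : ℝ) (s : A.State) : ∑ i, A.advantage t i s ^ 2 ≤ 1 := by
  refine sum_sq_correlation_le _ fun r => ?_
  have h0 : 0 ≤ (A.answer (streamOf (bits r)) s).real (Set.Ioi t) := measureReal_nonneg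
  have h1 : (A.answer (streamOf (bits r)) s).real (Set.Ioi t) ≤ 1 := measureReal_le_one
  nlinarith

theorem sq_advantage_le (t : ℝ) (i : Fin m) (s : A.State) : A.advantage t i s ^ 2 ≤ 1 :=
  (Finset.single_le_sum (f := fun i => A.advantage t i s ^ 2) (fun _ _ => sq_nonneg _)
    (Finset.mem_univ i)).trans (A.sum_sq_advantage_le t s)

theorem integrable_answer_real (μ : Measure A.State) [IsProbabilityMeasure μ] (T : Updates m)
    (t : ℝ) : Integrable (fun s => (A.answer T s).real (Set.Ioi t)) μ :=
  .of_bound (A.measurable_answer_real T t).aestronglyMeasurable 1 <| ae_of_all _ fun s => by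
    rw [Real.norm_of_nonneg measureReal_nonneg]; exact measureReal_le_one

theorem integrable_advantage (μ : Measure A.State) [IsProbabilityMeasure μ] (t : ℝ) (i : Fin m) :
    Integrable (A.advantage t i) μ :=
  .of_bound (A.measurable_advantage t i).aestronglyMeasurable 1 <| ae_of_all _ fun s =>
    (sq_le_one_iff_abs_le_one _).1 (A.sq_advantage_le t i s)

theorem integrable_sq_advantage (μ : Measure A.State) [IsProbabilityMeasure μ] (t : ℝ)
    (i : Fin m) : Integrable (fun s => A.advantage t i s ^ 2) μ :=
  .of_bound ((A.measurable_advantage t i).pow_const 2).aestronglyMeasurable 1 <|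
    ae_of_all _ fun s => by
      rw [Real.norm_of_nonneg (sq_nonneg _)]; exact A.sq_advantage_le t i s

variable {A}

/-- Accuracy holds for each fixed `r`, and `2α < d` keeps the accepted answers around `0` and around
`d` on opposite sides of `d / 2`. Averaging over `r` gives the bound. -/
theorem ApproximatesDotProd.le_integral_advantage {M : StreamModel} {α δ : ℝ}
    (h : A.ApproximatesDotProd M α δ) {d : ℕ} (hd : 2 * α < d) (i : Fin m) :
    1 - 2 * δ ≤ ∫ s, A.advantage (d / 2) i s ∂A.firstLaw [(i, (d : ℤ))] := by
  set μ := A.firstLaw [(i, (d : ℤ))] with hμ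
  have hint : ∀ r : Fin m → Bool, Integrable (fun s => sign i r *
      (2 * (A.answer (streamOf (bits r)) s).real (Set.Ioi ((d : ℝ) / 2)) - 1)) μ := fun r =>
    ((((A.integrable_answer_real μ (streamOf (bits r)) (d / 2)).const_mul 2).sub
      (integrable_const (1 : ℝ))).const_mul (sign i r))
  have key : ∀ r : Fin m → Bool, 1 - 2 * δ ≤
      ∫ s, sign i r * (2 * (A.answer (streamOf (bits r)) s).real (Set.Ioi ((d : ℝ) / 2)) - 1)
        ∂μ := by
    intro r
    have happrox := h [(i, (d : ℤ))] (streamOf (bits r)) (allows_singleton M i (by simp))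
      (allows_streamOf M fun k => by unfold bits; split_ifs <;> norm_num)
    rw [integral_const_mul, integral_sub ((A.integrable_answer_real μ _ _).const_mul 2)
      (integrable_const 1), integral_const_mul, hμ, ← A.law_real_snd _ _ measurableSet_Ioi]
    simp only [dotProd_singleton_streamOf, integral_const, probReal_univ, smul_eq_mul, one_mul]
      at happrox ⊢
    by_cases hr : r i
    · have hsub : {p : A.State × ℝ | |p.2 - (((d : ℤ) * bits r i : ℤ) : ℝ)| ≤ α} ⊆
          {p | p.2 ∈ Set.Ioi ((d : ℝ) / 2)} := by
        intro p hp
        simp only [bits, hr, Set.mem_ofPred_eq, if_true, mul_one, Int.cast_natCast, Set.mem_Ioi]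
          at hp ⊢
        linarith [(abs_le.1 hp).1]
      have := happrox.trans (measureReal_mono hsub)
      simp only [sign, hr, if_true]
      linarith
    · have hsub : {p : A.State × ℝ | |p.2 - (((d : ℤ) * bits r i : ℤ) : ℝ)| ≤ α} ⊆
          {p | p.2 ∈ Set.Ioi ((d : ℝ) / 2)}ᶜ := by
        intro p hp
        simp only [bits, hr, Set.mem_ofPred_eq, if_false, mul_zero, Int.cast_zero, sub_zero,
          Set.mem_Ioi, Set.mem_compl_iff, not_lt, Bool.false_eq_true] at hp ⊢
        linarith [(abs_le.1 hp).2]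
      have := happrox.trans (measureReal_mono hsub)
      have hmeas : MeasurableSet {p : A.State × ℝ | p.2 ∈ Set.Ioi ((d : ℝ) / 2)} :=
        measurable_snd measurableSet_Ioi
      rw [probReal_compl_eq_one_sub hmeas] at this
      simp only [sign, hr, if_false, Bool.false_eq_true]
      linarith
  simp only [advantage]
  rw [integral_div, integral_finsetSum _ fun r _ => hint r, le_div_iff₀ (by positivity)]
  calc (1 - 2 * δ) * 2 ^ m = ∑ _r : Fin m → Bool, (1 - 2 * δ) := by simp; ring
    _ ≤ _ := Finset.sum_le_sum fun r _ => key r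

/-- Accuracy with error probability `δ < 1 / 2` and `ε`-pan-privacy bound the size of the
universe. -/
theorem ApproximatesDotProd.card_le_of_isPanPrivate {M : StreamModel} {α δ ε : ℝ}
    (h : A.ApproximatesDotProd M α δ) (hδ : δ < 1 / 2) (hp : A.IsPanPrivate M ε) :
    (m - 1) * (1 - 2 * δ) ^ 2 ≤ Real.exp ε := by
  rcases Nat.eq_zero_or_pos m with hm | hm
  · subst hm
    have := Real.exp_pos ε
    push_cast
    nlinarith [sq_nonneg (1 - 2 * δ)]
  -- Update sizes are unbounded, so one update can outweigh any additive error.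
  obtain ⟨d, hd⟩ := exists_nat_gt (2 * α)
  let i₀ : Fin m := ⟨0, hm⟩
  set μ : Fin m → Measure A.State := fun i => A.firstLaw [(i, (d : ℤ))] with hμ
  have hμp : ∀ i, IsProbabilityMeasure (μ i) := fun i => A.isProbabilityMeasure_firstLaw _
  have hle : ∀ i ≠ i₀, (1 - 2 * δ) ^ 2 ≤
      Real.exp ε * ∫ s, A.advantage (d / 2) i s ^ 2 ∂μ i₀ := by
    intro i hi
    have h1 := h.le_integral_advantage hd i
    -- Jensen. Squares are nonnegative, as the change of measure in `h3` requires, and are what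
    -- Bessel controls.
    have h2 : (∫ s, A.advantage (d / 2) i s ∂μ i) ^ 2 ≤
        ∫ s, A.advantage (d / 2) i s ^ 2 ∂μ i :=
      (Even.convexOn_pow (𝕜 := ℝ) even_two).map_integral_le (continuous_pow 2).continuousOn
        isClosed_univ (ae_of_all _ fun _ => Set.mem_univ _) (A.integrable_advantage _ _ _)
        (A.integrable_sq_advantage _ _ _)
    have h3 : ∫ s, A.advantage (d / 2) i s ^ 2 ∂μ i ≤
        ∫ s, A.advantage (d / 2) i s ^ 2 ∂(ENNReal.ofReal (Real.exp ε) • μ i₀) :=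
      integral_mono_measure
        (hp.firstLaw_le (allows_singleton M i (by simp)) (allows_singleton M i₀ (by simp))
          (neighbors_singleton hi _))
        (ae_of_all _ fun s => sq_nonneg _)
        ((A.integrable_sq_advantage _ _ _).smul_measure ENNReal.ofReal_ne_top)
    rw [integral_smul_measure, ENNReal.toReal_ofReal (Real.exp_pos ε).le, smul_eq_mul] at h3
    exact ((pow_le_pow_left₀ (by linarith) h1 2).trans h2).trans h3
  have hsum : ∑ i, ∫ s, A.advantage (d / 2) i s ^ 2 ∂μ i₀ ≤ 1 := by
    rw [← integral_finsetSum _ fun i _ => A.integrable_sq_advantage _ _ _]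
    calc _ ≤ ∫ _, (1 : ℝ) ∂μ i₀ :=
          integral_mono (integrable_finsetSum _ fun i _ => A.integrable_sq_advantage _ _ _)
            (integrable_const 1) fun s => A.sum_sq_advantage_le _ s
      _ = 1 := by simp
  calc (m - 1) * (1 - 2 * δ) ^ 2 = ∑ _i ∈ Finset.univ.erase i₀, (1 - 2 * δ) ^ 2 := by
        simp [Finset.card_erase_of_mem, Nat.cast_sub (Nat.succ_le_of_lt hm)]
    _ ≤ ∑ i ∈ Finset.univ.erase i₀, Real.exp ε * ∫ s, A.advantage (d / 2) i s ^ 2 ∂μ i₀ :=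
        Finset.sum_le_sum fun i hi => hle i (Finset.ne_of_mem_erase hi)
    _ ≤ ∑ i, Real.exp ε * ∫ s, A.advantage (d / 2) i s ^ 2 ∂μ i₀ :=
        Finset.sum_le_sum_of_subset_of_nonneg (Finset.erase_subset _ _) fun i _ _ =>
          mul_nonneg (Real.exp_pos ε).le (integral_nonneg fun s => sq_nonneg _)
    _ ≤ Real.exp ε := by
        rw [← Finset.mul_sum]
        exact mul_le_of_le_one_right (Real.exp_pos ε).le hsum

end OnlineAlgorithm

end PanPrivacy

theorem mainTheorem7 (M : PanPrivacy.StreamModel)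
    (A : ∀ m : ℕ, PanPrivacy.OnlineAlgorithm.{u} m)
    (α : ℕ → ℝ) (hα : α =o[atTop] fun m : ℕ => √(m : ℝ))
    (δ η : ℝ) (hη : 0 < η) (hδ : δ < PanPrivacy.rhoStar / (2 * (1 + η)))
    (hA : ∀ᶠ m in atTop, (A m).ApproximatesDotProd M (α m) δ) :
    ∀ ε : ℝ, ∀ᶠ m in atTop, ¬ (A m).IsPanPrivate M ε := by
  intro ε
  -- Since `rhoStar` is a probability and `η > 0`, the bound on `δ` is below `1/2`.
  have hδ' : δ < 1 / 2 := by
    refine hδ.trans_le ((div_le_div_iff₀ (by positivity) two_pos).2 ?_)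
    linarith [PanPrivacy.rhoStar_le_one]
  have hc : 0 < (1 - 2 * δ) ^ 2 := pow_pos (by linarith) 2
  obtain ⟨N, hN⟩ := exists_nat_gt (Real.exp ε / (1 - 2 * δ) ^ 2 + 1)
  filter_upwards [hA, eventually_ge_atTop N] with m hm hNm hp
  have h1 := hm.card_le_of_isPanPrivate hδ' hp
  rw [← le_div_iff₀ hc] at h1
  have : (N : ℝ) ≤ m := Nat.cast_le.2 hNm
  linarith
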